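/- Let $E$ be an order complete (real) vector lattice, and let $\mathcal L_r(E)$ be the order complete vector lattice of all regular operators on $E$, i.e. of all differences of two positive linear operators $E\to E$, ordered by $S\le T$ iff $Sx\le Tx$ for all $x\ge 0$. A band is a solid linear subspace that contains the supremum of each of its nonempty subsets whose supremum exists. Let $\operatorname{Orth}(E)$ be the band in $\mathcal L_r(E)$ of all orthomorphisms (order bounded operators leaving every band of $E$ invariant), and let $\mathcal P_E\colon \mathcal L_r(E)\to\operatorname{Orth}(E)$ be the band projection; $\mathcal P_E(T)$ is the diagonal of $T$. For a band $B$ of $E$ with band projection $P_B$, let $\mathcal P_B(T)$ be the diagonal of the compression $P_BTP_B$ taken in the order complete vector lattice $B$, regarded as an operator on $E=B\oplus B^{d}$ that is zero on $B^{d}$. Then for each band $B$ of $E$ the set $$\{T\in \mathcal L_r(E):\ \mathcal P_E(T)=\mathcal P_B(T)\}$$ is a band in $\mathcal L_r(E)$. In particular, if $A$ is the atomic part of $E$, i.e. the band generated by all atoms of $E$ (vectors $a>0$ such that $0\le x,y\le a$ and $x\wedge y=0$ imply $x=0$ or $y=0$), then $\{T\in \mathcal L_r(E):\ \mathcal P_E(T)=\mathcal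 P_A(T)\}$, the set of regular operators whose diagonal equals their atomic diagonal $\mathcal P_A(T)$, is a band in $\mathcal L_r(E)$. -/

import Mathlib

/-!
# Regular operators, bands and diagonals on order complete vector lattices

An order complete (Dedekind complete) real vector lattice is a type `E` with
`[ConditionallyCompleteLattice E] [AddCommGroup E] [IsOrderedAddMonoid E] [Module ℝ E]
[IsOrderedModule ℝ E]`.
-/

namespace VecLat

set_option linter.unusedSectionVars false

/-! ### Auxiliary facts on vector lattices -/

section Basic

variable {V : Type*} [Lattice V] [AddCommGroup V] [IsOrderedAddMonoid V]

theorem inf_add_le {a b c : V} (ha : 0 ≤ a) (hb : 0 ≤ b) (hc : 0 ≤ c) :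
    (a + b) ⊓ c ≤ a ⊓ c + b ⊓ c := by
  have h1 : (a + b) ⊓ c - b ⊓ c ≤ a := by
    rw [sub_le_iff_le_add, add_inf]
    exact le_inf inf_le_left (inf_le_right.trans (le_add_of_nonneg_left ha))
  have h2 : (a + b) ⊓ c - b ⊓ c ≤ c := by
    rw [sub_le_iff_le_add]
    exact inf_le_right.trans (le_add_of_nonneg_right (le_inf hb hc))
  have := le_inf h1 h2
  rwa [sub_le_iff_le_add] at this

/-- The Riesz decomposition property. -/
theorem riesz_decomp {a b u v : V} (ha : 0 ≤ a) (hb : 0 ≤ b) (hu : 0 ≤ u) (hv : 0 ≤ v)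
    (h : a + b = u + v) :
    ∃ a₁ a₂ b₁ b₂ : V, 0 ≤ a₁ ∧ 0 ≤ a₂ ∧ 0 ≤ b₁ ∧ 0 ≤ b₂ ∧
      a₁ + a₂ = a ∧ b₁ + b₂ = b ∧ a₁ + b₁ = u ∧ a₂ + b₂ = v := by
  refine ⟨a ⊓ u, a - a ⊓ u, u - a ⊓ u, v - (a - a ⊓ u), le_inf ha hu,
    sub_nonneg.2 inf_le_left, sub_nonneg.2 inf_le_right, ?_, by abel, ?_, by abel, by abel⟩
  · rw [sub_nonneg, sub_le_comm]
    refine le_inf (sub_le_self _ hv) ?_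
    rw [sub_le_iff_le_add, ← h]
    exact le_add_of_nonneg_right hb
  · have : u + v - a = b := by rw [← h]; abel
    rw [← this]; abel

theorem abs_posPart_negPart_mem {s : Set V}
    (h : ∀ ⦃x y : V⦄, |y| ≤ |x| → x ∈ s → y ∈ s) {x : V} (hx : x ∈ s) :
    |x| ∈ s ∧ x⁺ ∈ s ∧ x⁻ ∈ s := by
  refine ⟨h (abs_abs x).le hx, h ?_ hx, h ?_ hx⟩
  · rw [abs_of_nonneg (posPart_nonneg x), ← posPart_add_negPart x]
    exact le_add_of_nonneg_right (negPart_nonneg x)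
  · rw [abs_of_nonneg (negPart_nonneg x), ← posPart_add_negPart x]
    exact le_add_of_nonneg_left (posPart_nonneg x)

end Basic

/-! ### Bands -/

/-- A band: a linear subspace that is solid (an ideal) and contains the supremum of each of its
nonempty subsets whose supremum exists in the whole space. -/
structure Band (V : Type*) [Lattice V] [AddCommGroup V] [Module ℝ V] extends
    Submodule ℝ V where
  solid' : ∀ ⦃x y : V⦄, |y| ≤ |x| → x ∈ carrier → y ∈ carrier
  sup_mem' : ∀ ⦃D : Set V⦄ ⦃x : V⦄, D ⊆ carrier → D.Nonempty → IsLUB D x → x ∈ carrier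

section BandBasic

variable {V : Type*} [Lattice V] [AddCommGroup V] [Module ℝ V]

instance : SetLike (Band V) V where
  coe M := M.carrier
  coe_injective M N h := by
    obtain ⟨M, _, _⟩ := M
    obtain ⟨N, _, _⟩ := N
    obtain rfl : M = N := SetLike.coe_injective h
    rfl

namespace Band

theorem mem_toSubmodule {M : Band V} {x : V} : x ∈ M.toSubmodule ↔ x ∈ M := Iff.rfl

theorem solid (M : Band V) {x y : V} (h : |y| ≤ |x|) (hx : x ∈ M) : y ∈ M := M.solid' h hx

theorem sup_mem (M : Band V) {D : Set V} {x : V} (hD : ∀ y ∈ D, y ∈ M) (h0 : D.Nonempty)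
    (hx : IsLUB D x) : x ∈ M := M.sup_mem' hD h0 hx

theorem zero_mem (M : Band V) : (0 : V) ∈ M := M.toSubmodule.zero_mem
theorem add_mem (M : Band V) {x y : V} (hx : x ∈ M) (hy : y ∈ M) : x + y ∈ M :=
  M.toSubmodule.add_mem hx hy
theorem sub_mem (M : Band V) {x y : V} (hx : x ∈ M) (hy : y ∈ M) : x - y ∈ M :=
  M.toSubmodule.sub_mem hx hy
theorem neg_mem (M : Band V) {x : V} (hx : x ∈ M) : -x ∈ M :=
  M.toSubmodule.neg_mem hx
theorem smul_mem (M : Band V) (c : ℝ) {x : V} (hx : x ∈ M) : c • x ∈ M :=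
  M.toSubmodule.smul_mem c hx

/-- The band generated by a set: the intersection of all bands that contain it. -/
def generated (S : Set V) : Band V where
  carrier := {x | ∀ M : Band V, S ⊆ (M : Set V) → x ∈ M}
  add_mem' hx hy M hM := M.add_mem (hx M hM) (hy M hM)
  zero_mem' M _ := M.zero_mem
  smul_mem' c _ hx M hM := M.smul_mem c (hx M hM)
  solid' _ _ h hx M hM := M.solid h (hx M hM)
  sup_mem' _ _ hD h0 hx M hM := M.sup_mem (fun _ hy => hD hy M hM) h0 hx

end Band

/-- `a` is an atom: `a > 0`, and of two disjoint elements of `[0, a]` one vanishes. -/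
def IsVecAtom (a : V) : Prop :=
  0 < a ∧ ∀ x y : V, 0 ≤ x → x ≤ a → 0 ≤ y → y ≤ a → |x| ⊓ |y| = 0 → x = 0 ∨ y = 0

/-- The atomic part: the band generated by all atoms. -/
def atomicPart (V : Type*) [Lattice V] [AddCommGroup V] [Module ℝ V] : Band V :=
  Band.generated {a | IsVecAtom a}

/-- The disjoint complement of a set. -/
def disjointCompl (S : Set V) : Set V := {x | ∀ y ∈ S, |x| ⊓ |y| = 0}

theorem disjointCompl_sub [IsOrderedAddMonoid V] {S : Set V} {x y : V}
    (hx : x ∈ disjointCompl S) (hy : y ∈ disjointCompl S) : x - y ∈ disjointCompl S := by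
  intro z hz
  refine le_antisymm ?_ (le_inf (abs_nonneg _) (abs_nonneg _))
  calc |x - y| ⊓ |z| ≤ (|x| + |y|) ⊓ |z| := by
        refine inf_le_inf_right _ ?_
        rw [sub_eq_add_neg]
        simpa using abs_add_le x (-y)
    _ ≤ |x| ⊓ |z| + |y| ⊓ |z| := inf_add_le (abs_nonneg _) (abs_nonneg _) (abs_nonneg _)
    _ = 0 := by rw [hx z hz, hy z hz, add_zero]

theorem disjointCompl_add [IsOrderedAddMonoid V] {S : Set V} {x y : V}
    (hx : x ∈ disjointCompl S) (hy : y ∈ disjointCompl S) : x + y ∈ disjointCompl S := by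
  have : -y ∈ disjointCompl S := fun z hz => by rw [abs_neg]; exact hy z hz
  simpa using disjointCompl_sub hx this

theorem abs_smul_le [IsOrderedAddMonoid V] [IsOrderedModule ℝ V] (c : ℝ) (x : V) :
    |c • x| ≤ |c| • |x| := by
  refine abs_le'.2 ⟨?_, ?_⟩
  swap
  · rcases le_total 0 c with h | h
    · rw [abs_of_nonneg h, ← smul_neg]
      exact smul_le_smul_of_nonneg_left (neg_le_abs x) h
    · rw [abs_of_nonpos h, ← neg_smul]
      exact smul_le_smul_of_nonneg_left (le_abs_self x) (neg_nonneg.2 h)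
  · rcases le_total 0 c with h | h
    · rw [abs_of_nonneg h]
      exact smul_le_smul_of_nonneg_left (le_abs_self x) h
    · rw [abs_of_nonpos h, ← neg_smul_neg]
      exact smul_le_smul_of_nonneg_left (neg_le_abs x) (neg_nonneg.2 h)

end BandBasic

/-! ### Band projections in order complete vector lattices -/

section Projection

variable {V : Type*} [ConditionallyCompleteLattice V] [AddCommGroup V] [IsOrderedAddMonoid V]
  [Module ℝ V]

namespace Band

theorem eq_zero_of_mem_disjointCompl (M : Band V) {x : V} (hx : x ∈ M)
    (h : x ∈ disjointCompl (M : Set V)) : x = 0 := by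
  have h0 : |x| = 0 := by simpa using h x hx
  exact le_antisymm ((le_abs_self x).trans h0.le) (neg_nonpos.1 ((neg_le_abs x).trans h0.le))

/-- In an order complete vector lattice every band is a projection band. -/
theorem exists_proj_of_nonneg (M : Band V) {x : V} (hx : 0 ≤ x) :
    ∃ y ∈ M, 0 ≤ y ∧ x - y ∈ disjointCompl (M : Set V) := by
  let D : Set V := {z | z ∈ M ∧ 0 ≤ z ∧ z ≤ x}
  have h0 : (0 : V) ∈ D := ⟨M.zero_mem, le_rfl, hx⟩
  have hlub : IsLUB D (sSup D) := isLUB_csSup ⟨0, h0⟩ ⟨x, fun z hz => hz.2.2⟩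
  have hyM : sSup D ∈ M := M.sup_mem (fun y hy => hy.1) ⟨0, h0⟩ hlub
  have hyx : sSup D ≤ x := hlub.2 fun z hz => hz.2.2
  have hy0 : 0 ≤ sSup D := hlub.1 h0
  refine ⟨sSup D, hyM, hy0, fun w hw => ?_⟩
  rw [abs_of_nonneg (sub_nonneg.2 hyx)]
  have hu0 : 0 ≤ (x - sSup D) ⊓ |w| := le_inf (sub_nonneg.2 hyx) (abs_nonneg w)
  have huM : (x - sSup D) ⊓ |w| ∈ M := by
    refine M.solid ?_ hw
    rw [abs_of_nonneg hu0]
    exact inf_le_right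
  refine le_antisymm ?_ hu0
  have : sSup D + (x - sSup D) ⊓ |w| ≤ sSup D := by
    refine hlub.1 ⟨M.add_mem hyM huM, add_nonneg hy0 hu0, ?_⟩
    rw [← le_sub_iff_add_le']
    exact inf_le_left
  simpa using this

theorem exists_proj (M : Band V) (x : V) : ∃ y ∈ M, x - y ∈ disjointCompl (M : Set V) := by
  obtain ⟨y, hy, _, hy'⟩ := M.exists_proj_of_nonneg (posPart_nonneg x)
  obtain ⟨z, hz, _, hz'⟩ := M.exists_proj_of_nonneg (negPart_nonneg x)
  refine ⟨y - z, M.sub_mem hy hz, ?_⟩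
  have := disjointCompl_sub hy' hz'
  rwa [sub_sub_sub_comm, posPart_sub_negPart] at this

theorem proj_unique (M : Band V) {x y z : V} (hy : y ∈ M)
    (hy' : x - y ∈ disjointCompl (M : Set V)) (hz : z ∈ M)
    (hz' : x - z ∈ disjointCompl (M : Set V)) : y = z := by
  refine sub_eq_zero.1 (M.eq_zero_of_mem_disjointCompl (M.sub_mem hy hz) ?_)
  have := disjointCompl_sub hz' hy'
  rwa [sub_sub_sub_cancel_left] at this

variable [IsOrderedModule ℝ V]

theorem disjointCompl_smul (M : Band V) (c : ℝ) {x : V}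
    (hx : x ∈ disjointCompl (M : Set V)) : c • x ∈ disjointCompl (M : Set V) := by
  by_cases hc : c = 0
  · subst hc
    intro y _
    simp
  intro y hy
  refine le_antisymm ?_ (le_inf (abs_nonneg _) (abs_nonneg _))
  have hc' : (0 : ℝ) < |c| := abs_pos.2 hc
  have key : |c|⁻¹ • (|c • x| ⊓ |y|) ≤ 0 := by
    have hmem : |c|⁻¹ • y ∈ M := M.smul_mem _ hy
    rw [← hx _ hmem]
    refine le_inf ?_ ?_
    · calc |c|⁻¹ • (|c • x| ⊓ |y|) ≤ |c|⁻¹ • (|c| • |x|) :=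
            smul_le_smul_of_nonneg_left (inf_le_left.trans (abs_smul_le c x)) (by positivity)
        _ = |x| := by rw [smul_smul, inv_mul_cancel₀ hc'.ne', one_smul]
    · have h1 : |y| ≤ |c| • |(|c|⁻¹ • y)| := by
        have := abs_smul_le |c| (|c|⁻¹ • y)
        rwa [smul_smul, mul_inv_cancel₀ hc'.ne', one_smul, abs_abs] at this
      calc |c|⁻¹ • (|c • x| ⊓ |y|) ≤ |c|⁻¹ • (|c| • |(|c|⁻¹ • y)|) :=
            smul_le_smul_of_nonneg_left (inf_le_right.trans h1) (by positivity)
        _ = _ := by rw [smul_smul, inv_mul_cancel₀ hc'.ne', one_smul]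
  have := smul_le_smul_of_nonneg_left key hc'.le
  rwa [smul_smul, mul_inv_cancel₀ hc'.ne', one_smul, smul_zero] at this

/-- The band projection of `V` onto the band `M`, along the disjoint complement of `M`: the value
at `x` is the unique `y ∈ M` with `x - y ∈ Mᵈ`. -/
noncomputable def proj (M : Band V) : V →ₗ[ℝ] V where
  toFun x := (M.exists_proj x).choose
  map_add' x y := by
    have hx := (M.exists_proj x).choose_spec
    have hy := (M.exists_proj y).choose_spec
    have hxy := (M.exists_proj (x + y)).choose_spec
    refine M.proj_unique hxy.1 hxy.2 (M.add_mem hx.1 hy.1) ?_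
    have := disjointCompl_add hx.2 hy.2
    rwa [sub_add_sub_comm] at this
  map_smul' c x := by
    have hx := (M.exists_proj x).choose_spec
    have hcx := (M.exists_proj (c • x)).choose_spec
    refine M.proj_unique hcx.1 hcx.2 (M.smul_mem c hx.1) ?_
    have := M.disjointCompl_smul c hx.2
    rwa [smul_sub] at this

theorem proj_mem (M : Band V) (x : V) : M.proj x ∈ M := (M.exists_proj x).choose_spec.1

theorem sub_proj_mem (M : Band V) (x : V) : x - M.proj x ∈ disjointCompl (M : Set V) :=
  (M.exists_proj x).choose_spec.2

theorem proj_nonneg (M : Band V) {x : V} (hx : 0 ≤ x) : 0 ≤ M.proj x := by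
  obtain ⟨y, hy, hy0, hy'⟩ := M.exists_proj_of_nonneg hx
  rwa [M.proj_unique (M.proj_mem x) (M.sub_proj_mem x) hy hy']

end Band

end Projection

/-! ### A band is itself an order complete vector lattice -/

section BandLattice

variable {V : Type*} [ConditionallyCompleteLattice V] [AddCommGroup V] [IsOrderedAddMonoid V]
  [Module ℝ V]

namespace Band

theorem sup_mem_pair (B : Band V) {x y : V} (hx : x ∈ B) (hy : y ∈ B) : x ⊔ y ∈ B :=
  B.sup_mem (D := {x, y}) (by rintro z (rfl | rfl) <;> assumption) ⟨x, by simp⟩ isLUB_pair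

theorem inf_mem_pair (B : Band V) {x y : V} (hx : x ∈ B) (hy : y ∈ B) : x ⊓ y ∈ B := by
  have := B.neg_mem (B.sup_mem_pair (B.neg_mem hx) (B.neg_mem hy))
  rwa [neg_sup, neg_neg, neg_neg] at this

theorem exists_isLUB (B : Band V) (s : Set B.toSubmodule) (h0 : s.Nonempty) (hb : BddAbove s) :
    ∃ a, IsLUB s a := by
  obtain ⟨u, hu⟩ := hb
  have hlub : IsLUB ((↑) '' s : Set V) (sSup ((↑) '' s : Set V)) :=
    isLUB_csSup (h0.image _) ⟨(u : V), by rintro _ ⟨x, hx, rfl⟩; exact hu hx⟩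
  refine ⟨⟨sSup ((↑) '' s : Set V), B.sup_mem (by rintro _ ⟨x, hx, rfl⟩; exact x.2)
    (h0.image _) hlub⟩, fun x hx => hlub.1 ⟨x, hx, rfl⟩, fun w hw => hlub.2 ?_⟩
  rintro _ ⟨x, hx, rfl⟩
  exact hw hx

theorem exists_isGLB (B : Band V) (s : Set B.toSubmodule) (h0 : s.Nonempty) (hb : BddBelow s) :
    ∃ a, IsGLB s a := by
  obtain ⟨a, ha⟩ := B.exists_isLUB (-s) h0.neg (bddAbove_neg.2 hb)
  exact ⟨-a, isLUB_neg.1 ha⟩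

open Classical in
/-- The order is the one inherited from the ambient space. -/
noncomputable instance (B : Band V) : ConditionallyCompleteLattice B.toSubmodule where
  toPartialOrder := Subtype.partialOrder _
  sup x y := ⟨(x : V) ⊔ (y : V), B.sup_mem_pair x.2 y.2⟩
  le_sup_left x y := (le_sup_left : (x : V) ≤ (x : V) ⊔ (y : V))
  le_sup_right x y := (le_sup_right : (y : V) ≤ (x : V) ⊔ (y : V))
  sup_le x y z h h' := (sup_le h h' : (x : V) ⊔ (y : V) ≤ (z : V))
  inf x y := ⟨(x : V) ⊓ (y : V), B.inf_mem_pair x.2 y.2⟩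
  inf_le_left x y := (inf_le_left : (x : V) ⊓ (y : V) ≤ (x : V))
  inf_le_right x y := (inf_le_right : (x : V) ⊓ (y : V) ≤ (y : V))
  le_inf x y z h h' := (le_inf h h' : (x : V) ≤ (y : V) ⊓ (z : V))
  sSup s := if h : ∃ a, IsLUB s a then h.choose else 0
  sInf s := if h : ∃ a, IsGLB s a then h.choose else 0
  isLUB_csSup s h0 hb := by
    have h := B.exists_isLUB s h0 hb
    simp only [dif_pos h]
    exact h.choose_spec
  isGLB_csInf s h0 hb := by
    have h := B.exists_isGLB s h0 hb
    simp only [dif_pos h]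
    exact h.choose_spec

instance (B : Band V) : IsOrderedAddMonoid B.toSubmodule where
  add_le_add_left x y h z := add_le_add_left (show (x : V) ≤ y from h) (z : V)

instance [IsOrderedModule ℝ V] (B : Band V) : IsOrderedModule ℝ B.toSubmodule where
  smul_le_smul_of_nonneg_left c hc x y h :=
    show c • (x : V) ≤ c • (y : V) from
      smul_le_smul_of_nonneg_left (show (x : V) ≤ y from h) hc
  smul_le_smul_of_nonneg_right x hx c d h :=
    show c • (x : V) ≤ d • (x : V) from
      smul_le_smul_of_nonneg_right h (show (0 : V) ≤ x from hx)

end Band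

end BandLattice

/-! ### Regular operators -/

section Regular

variable {E : Type*} [ConditionallyCompleteLattice E] [AddCommGroup E] [IsOrderedAddMonoid E]
  [Module ℝ E]

/-- A linear operator is positive if it maps positive vectors to positive vectors. -/
def IsPositiveOp {F : Type*} [Lattice F] [AddCommGroup F] [Module ℝ F] (T : E →ₗ[ℝ] F) : Prop :=
  ∀ x, 0 ≤ x → 0 ≤ T x

variable [IsOrderedModule ℝ E]

variable (E) in
/-- The space of regular operators, i.e. of differences of two positive operators. -/
def regularSubmodule : Submodule ℝ (E →ₗ[ℝ] E) where
  carrier := {T | ∃ P Q : E →ₗ[ℝ] E, IsPositiveOp P ∧ IsPositiveOp Q ∧ T = P - Q}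
  add_mem' := by
    rintro _ _ ⟨P, Q, hP, hQ, rfl⟩ ⟨P', Q', hP', hQ', rfl⟩
    exact ⟨P + P', Q + Q', fun x hx => add_nonneg (hP x hx) (hP' x hx),
      fun x hx => add_nonneg (hQ x hx) (hQ' x hx), by abel⟩
  zero_mem' := ⟨0, 0, fun _ _ => le_rfl, fun _ _ => le_rfl, by simp⟩
  smul_mem' := by
    rintro c _ ⟨P, Q, hP, hQ, rfl⟩
    rcases le_total 0 c with h | h
    · exact ⟨c • P, c • Q, fun x hx => smul_nonneg h (hP x hx),
        fun x hx => smul_nonneg h (hQ x hx), smul_sub _ _ _⟩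
    · refine ⟨(-c) • Q, (-c) • P, fun x hx => smul_nonneg (neg_nonneg.2 h) (hQ x hx),
        fun x hx => smul_nonneg (neg_nonneg.2 h) (hP x hx), ?_⟩
      rw [smul_sub, neg_smul, neg_smul]
      abel

variable (E) in
/-- The space `L_r(E)` of regular operators on `E`. -/
def RegOp : Type _ := regularSubmodule E

namespace RegOp

noncomputable instance : AddCommGroup (RegOp E) := inferInstanceAs (AddCommGroup (regularSubmodule E))
noncomputable instance : Module ℝ (RegOp E) := inferInstanceAs (Module ℝ (regularSubmodule E))

/-- The underlying linear operator. -/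
def toLin (T : RegOp E) : E →ₗ[ℝ] E := T.1

theorem toLin_injective : Function.Injective (toLin : RegOp E → E →ₗ[ℝ] E) :=
  Subtype.val_injective

@[simp] theorem toLin_add (T S : RegOp E) : (T + S).toLin = T.toLin + S.toLin := rfl
@[simp] theorem toLin_sub (T S : RegOp E) : (T - S).toLin = T.toLin - S.toLin := rfl
@[simp] theorem toLin_neg (T : RegOp E) : (-T).toLin = -T.toLin := rfl
@[simp] theorem toLin_zero : (0 : RegOp E).toLin = 0 := rfl
@[simp] theorem toLin_smul (c : ℝ) (T : RegOp E) : (c • T).toLin = c • T.toLin := rfl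

theorem ext_nonneg {T S : E →ₗ[ℝ] E} (h : ∀ x, 0 ≤ x → T x = S x) : T = S := by
  ext x
  rw [← posPart_sub_negPart x, map_sub, map_sub, h _ (posPart_nonneg x), h _ (negPart_nonneg x)]

/-- The operator order: `T ≤ S` iff `S - T` is positive. -/
instance : PartialOrder (RegOp E) where
  le T S := ∀ x, 0 ≤ x → T.toLin x ≤ S.toLin x
  le_refl _ _ _ := le_rfl
  le_trans _ _ _ h h' x hx := (h x hx).trans (h' x hx)
  le_antisymm _ _ h h' := toLin_injective (ext_nonneg fun x hx => (h x hx).antisymm (h' x hx))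

theorem le_def {T S : RegOp E} : T ≤ S ↔ ∀ x, 0 ≤ x → T.toLin x ≤ S.toLin x := Iff.rfl

instance : IsOrderedAddMonoid (RegOp E) where
  add_le_add_left _ _ h S x hx := add_le_add_left (h x hx) (S.toLin x)

instance : IsOrderedModule ℝ (RegOp E) where
  smul_le_smul_of_nonneg_left _ hc _ _ h x hx := smul_le_smul_of_nonneg_left (h x hx) hc
  smul_le_smul_of_nonneg_right T hT _ _ h x hx :=
    smul_le_smul_of_nonneg_right h (show (0 : E) ≤ T.toLin x from hT x hx)

/-- Extension of an additive and homogeneous map on the positive cone to a linear operator. -/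
theorem exists_extension (f : E → E) (hadd : ∀ x y, 0 ≤ x → 0 ≤ y → f (x + y) = f x + f y)
    (hsmul : ∀ (c : ℝ) x, 0 < c → 0 ≤ x → f (c • x) = c • f x) :
    ∃ R : E →ₗ[ℝ] E, ∀ x, 0 ≤ x → R x = f x := by
  have h0 : f 0 = 0 := by simpa using hadd 0 0 le_rfl le_rfl
  have key : ∀ a b c d : E, 0 ≤ a → 0 ≤ b → 0 ≤ c → 0 ≤ d → a - b = c - d →
      f a - f b = f c - f d := by
    intro a b c d ha hb hc hd h
    rw [sub_eq_sub_iff_add_eq_add] at h ⊢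
    rw [← hadd a d ha hd, ← hadd c b hc hb, h]
  have hp : ∀ x : E, 0 ≤ x⁺ := posPart_nonneg
  have hn : ∀ x : E, 0 ≤ x⁻ := negPart_nonneg
  refine ⟨{ toFun := fun x => f x⁺ - f x⁻, map_add' := fun x y => ?_,
            map_smul' := fun c x => ?_ }, fun x hx => ?_⟩
  · rw [key (x + y)⁺ (x + y)⁻ (x⁺ + y⁺) (x⁻ + y⁻) (hp _) (hn _) (add_nonneg (hp _) (hp _))
      (add_nonneg (hn _) (hn _)), hadd _ _ (hp _) (hp _), hadd _ _ (hn _) (hn _)]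
    · abel
    · rw [posPart_sub_negPart, add_sub_add_comm, posPart_sub_negPart, posPart_sub_negPart]
  · simp only [RingHom.id_apply]
    rcases lt_trichotomy c 0 with h | rfl | h
    · have h' : 0 < -c := neg_pos.2 h
      rw [key (c • x)⁺ (c • x)⁻ ((-c) • x⁻) ((-c) • x⁺) (hp _) (hn _) (smul_nonneg h'.le (hn _))
        (smul_nonneg h'.le (hp _)), hsmul _ _ h' (hp _), hsmul _ _ h' (hn _)]
      · rw [neg_smul, neg_smul, smul_sub]; abel
      · rw [posPart_sub_negPart, ← smul_sub, ← neg_sub x⁺, posPart_sub_negPart, neg_smul_neg]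
    · simp
    · rw [key (c • x)⁺ (c • x)⁻ (c • x⁺) (c • x⁻) (hp _) (hn _) (smul_nonneg h.le (hp _))
        (smul_nonneg h.le (hn _)), hsmul _ _ h (hp _), hsmul _ _ h (hn _), smul_sub]
      rw [posPart_sub_negPart, ← smul_sub, posPart_sub_negPart]
  · change f x⁺ - f x⁻ = f x
    rw [posPart_of_nonneg hx, negPart_of_nonneg hx, h0, sub_zero]

/-- The pairs `(∑ xᵢ, ∑ Tᵢ xᵢ)` with finitely many `xᵢ ≥ 0` and `Tᵢ ∈ D`. -/
def sums (D : Set (RegOp E)) : AddSubmonoid (E × E) :=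
  AddSubmonoid.closure {p | ∃ T ∈ D, 0 ≤ p.1 ∧ p.2 = T.toLin p.1}

theorem sums_basic {D : Set (RegOp E)} {T : RegOp E} (hT : T ∈ D) {x : E} (hx : 0 ≤ x) :
    (x, T.toLin x) ∈ sums D :=
  AddSubmonoid.subset_closure ⟨T, hT, hx, rfl⟩

theorem sums_nonneg {D : Set (RegOp E)} {p : E × E} (hp : p ∈ sums D) : 0 ≤ p.1 := by
  induction hp using AddSubmonoid.closure_induction with
  | mem p hp => obtain ⟨T, _, h, _⟩ := hp; exact h
  | zero => exact le_rfl
  | add p q _ _ hp hq => exact add_nonneg hp hq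

theorem sums_le {D : Set (RegOp E)} {U : RegOp E} (hU : U ∈ upperBounds D) {p : E × E}
    (hp : p ∈ sums D) : p.2 ≤ U.toLin p.1 := by
  induction hp using AddSubmonoid.closure_induction with
  | mem p hp => obtain ⟨T, hT, h, h'⟩ := hp; rw [h']; exact hU hT _ h
  | zero => simp
  | add p q _ _ hp hq => simpa using add_le_add hp hq

theorem sums_smul {D : Set (RegOp E)} {c : ℝ} (hc : 0 ≤ c) {p : E × E}
    (hp : p ∈ sums D) : c • p ∈ sums D := by
  induction hp using AddSubmonoid.closure_induction with
  | mem p hp =>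
    obtain ⟨T, hT, h, h'⟩ := hp
    refine AddSubmonoid.subset_closure ⟨T, hT, smul_nonneg hc h, ?_⟩
    simp [h']
  | zero => simp
  | add p q _ _ hp hq => rw [smul_add]; exact add_mem hp hq

theorem sums_split {D : Set (RegOp E)} {p : E × E} (hp : p ∈ sums D) :
    ∀ u v : E, 0 ≤ u → 0 ≤ v → p.1 = u + v →
      ∃ y z : E, (u, y) ∈ sums D ∧ (v, z) ∈ sums D ∧ p.2 = y + z := by
  induction hp using AddSubmonoid.closure_induction with
  | mem p hp =>
    obtain ⟨T, hT, h, h'⟩ := hp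
    intro u v hu hv huv
    exact ⟨_, _, sums_basic hT hu, sums_basic hT hv, by rw [h', huv, map_add]⟩
  | zero =>
    intro u v hu hv huv
    have huv' : u + v = 0 := huv.symm
    obtain ⟨rfl, rfl⟩ := (add_eq_zero_iff_of_nonneg hu hv).1 huv'
    exact ⟨0, 0, (sums D).zero_mem, (sums D).zero_mem, by simp⟩
  | add p q hp' hq' hp hq =>
    intro u v hu hv huv
    obtain ⟨a₁, a₂, b₁, b₂, ha₁, ha₂, hb₁, hb₂, ha, hb, rfl, rfl⟩ :=
      riesz_decomp (sums_nonneg hp') (sums_nonneg hq') hu hv huv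
    obtain ⟨y, z, hy, hz, h⟩ := hp a₁ a₂ ha₁ ha₂ ha.symm
    obtain ⟨y', z', hy', hz', h'⟩ := hq b₁ b₂ hb₁ hb₂ hb.symm
    refine ⟨y + y', z + z', add_mem hy hy', add_mem hz hz', ?_⟩
    rw [Prod.snd_add, h, h']
    abel

/-- The Riesz–Kantorovich formula: a nonempty set of regular operators that is bounded above has a
supremum `R`, and `R x = sup {∑ Tᵢ xᵢ : ∑ xᵢ = x}` for all `x ≥ 0`. -/
theorem exists_isLUB_formula {D : Set (RegOp E)} (h0 : D.Nonempty) (hb : BddAbove D) :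
    ∃ R : RegOp E, IsLUB D R ∧ ∀ x, 0 ≤ x → IsLUB {y | (x, y) ∈ sums D} (R.toLin x) := by
  obtain ⟨U, hU⟩ := hb
  obtain ⟨T₀, hT₀⟩ := h0
  have hlub : ∀ x : E, 0 ≤ x → IsLUB {y | (x, y) ∈ sums D} (sSup {y | (x, y) ∈ sums D}) :=
    fun x hx => isLUB_csSup ⟨_, sums_basic hT₀ hx⟩ ⟨U.toLin x, fun y hy => sums_le hU hy⟩
  obtain ⟨R, hR⟩ := exists_extension (fun x => sSup {y | (x, y) ∈ sums D})
    (by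
      intro x y hx hy
      refine (hlub _ (add_nonneg hx hy)).unique ⟨?_, ?_⟩
      · intro w hw
        obtain ⟨a, b, ha, hb, h⟩ := sums_split hw x y hx hy rfl
        change w = a + b at h
        rw [h]
        exact add_le_add ((hlub x hx).1 ha) ((hlub y hy).1 hb)
      · intro w hw
        rw [← le_sub_iff_add_le]
        refine (hlub x hx).2 fun a ha => ?_
        rw [le_sub_comm]
        refine (hlub y hy).2 fun b hb => ?_
        rw [le_sub_iff_add_le']
        exact hw (add_mem ha hb : (x, a) + (y, b) ∈ sums D))
    (by
      intro c x hc hx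
      refine (hlub _ (smul_nonneg hc.le hx)).unique ⟨?_, ?_⟩
      · intro w hw
        have h1 : (x, c⁻¹ • w) ∈ sums D := by
          have := sums_smul (inv_nonneg.2 hc.le) hw
          rwa [Prod.smul_mk, smul_smul, inv_mul_cancel₀ hc.ne', one_smul] at this
        have h2 := smul_le_smul_of_nonneg_left ((hlub x hx).1 h1) hc.le
        rwa [smul_smul, mul_inv_cancel₀ hc.ne', one_smul] at h2
      · intro w hw
        have h1 : sSup {y | (x, y) ∈ sums D} ≤ c⁻¹ • w := by
          refine (hlub x hx).2 fun a ha => ?_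
          have h2 := smul_le_smul_of_nonneg_left (hw (sums_smul hc.le ha : c • (x, a) ∈ sums D))
            (inv_nonneg.2 hc.le)
          rwa [smul_smul, inv_mul_cancel₀ hc.ne', one_smul] at h2
        have h2 := smul_le_smul_of_nonneg_left h1 hc.le
        rwa [smul_smul, mul_inv_cancel₀ hc.ne', one_smul] at h2)
  have hR' : ∀ x, 0 ≤ x → IsLUB {y | (x, y) ∈ sums D} (R x) := fun x hx => by
    rw [hR x hx]; exact hlub x hx
  have hreg : R ∈ regularSubmodule E := by
    have h1 : U.toLin - R ∈ regularSubmodule E :=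
      ⟨U.toLin - R, 0, fun x hx => by
        rw [LinearMap.sub_apply, sub_nonneg]
        exact (hR' x hx).2 fun y hy => sums_le hU hy, fun _ _ => le_rfl, by simp⟩
    have h2 := (regularSubmodule E).sub_mem U.2 h1
    have h3 : U.1 - (U.toLin - R) = R := sub_sub_cancel _ _
    rwa [h3] at h2
  refine ⟨⟨R, hreg⟩, ⟨fun T hT x hx => (hR' x hx).1 (sums_basic hT hx), fun W hW x hx => ?_⟩, hR'⟩
  exact (hR' x hx).2 fun y hy => sums_le hW hy

theorem isLUB_apply {D : Set (RegOp E)} (h0 : D.Nonempty) {R : RegOp E} (hR : IsLUB D R) {x : E}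
    (hx : 0 ≤ x) : IsLUB {y | (x, y) ∈ sums D} (R.toLin x) := by
  obtain ⟨R', h, h'⟩ := exists_isLUB_formula h0 ⟨R, hR.1⟩
  rw [hR.unique h]
  exact h' x hx

theorem exists_isGLB {D : Set (RegOp E)} (h0 : D.Nonempty) (hb : BddBelow D) :
    ∃ R, IsGLB D R := by
  obtain ⟨a, ha, _⟩ := exists_isLUB_formula h0.neg (bddAbove_neg.2 hb)
  exact ⟨-a, isLUB_neg.1 ha⟩

theorem bddAbove_pair (T S : RegOp E) : BddAbove {T, S} := by
  obtain ⟨P, Q, hP, hQ, h⟩ := T.2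
  obtain ⟨P', Q', hP', hQ', h'⟩ := S.2
  refine ⟨⟨P + P', P + P', 0, fun x hx => add_nonneg (hP x hx) (hP' x hx), fun _ _ => le_rfl,
    by simp⟩, ?_⟩
  rintro W (rfl | rfl) x hx
  · change W.1 x ≤ P x + P' x
    rw [h, LinearMap.sub_apply]
    exact (sub_le_self _ (hQ x hx)).trans (le_add_of_nonneg_right (hP' x hx))
  · change W.1 x ≤ P x + P' x
    rw [h', LinearMap.sub_apply]
    exact (sub_le_self _ (hQ' x hx)).trans (le_add_of_nonneg_left (hP x hx))

theorem bddBelow_pair (T S : RegOp E) : BddBelow {T, S} := by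
  obtain ⟨U, hU⟩ := bddAbove_pair (-T) (-S)
  refine ⟨-U, ?_⟩
  rintro W (rfl | rfl)
  · exact neg_le.1 (hU (by simp))
  · exact neg_le.1 (hU (by simp))

theorem exists_sup (T S : RegOp E) : ∃ R, IsLUB {T, S} R :=
  (exists_isLUB_formula ⟨T, by simp⟩ (bddAbove_pair T S)).imp fun _ h => h.1

theorem exists_inf (T S : RegOp E) : ∃ R, IsGLB {T, S} R :=
  exists_isGLB ⟨T, by simp⟩ (bddBelow_pair T S)

open Classical in
/-- `L_r(E)` is an order complete vector lattice for the operator order. -/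
noncomputable instance : ConditionallyCompleteLattice (RegOp E) where
  toPartialOrder := inferInstance
  sup T S := (exists_sup T S).choose
  le_sup_left T S := (exists_sup T S).choose_spec.1 (by simp)
  le_sup_right T S := (exists_sup T S).choose_spec.1 (by simp)
  sup_le T S W h h' := (exists_sup T S).choose_spec.2 (by rintro _ (rfl | rfl) <;> assumption)
  inf T S := (exists_inf T S).choose
  inf_le_left T S := (exists_inf T S).choose_spec.1 (by simp)
  inf_le_right T S := (exists_inf T S).choose_spec.1 (by simp)
  le_inf W T S h h' := (exists_inf T S).choose_spec.2 (by rintro _ (rfl | rfl) <;> assumption)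
  sSup s := if h : ∃ a, IsLUB s a then h.choose else 0
  sInf s := if h : ∃ a, IsGLB s a then h.choose else 0
  isLUB_csSup s h0 hb := by
    have h : ∃ a, IsLUB s a := (exists_isLUB_formula h0 hb).imp fun _ h => h.1
    simp only [dif_pos h]
    exact h.choose_spec
  isGLB_csInf s h0 hb := by
    have h := exists_isGLB h0 hb
    simp only [dif_pos h]
    exact h.choose_spec

theorem abs_apply_le (T : RegOp E) (x : E) : |T.toLin x| ≤ (|T|).toLin |x| := by
  have h1 : T ≤ |T| := le_abs_self T
  have h2 : -T ≤ |T| := neg_le_abs T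
  have hp := posPart_nonneg x
  have hn := negPart_nonneg x
  have e : T.toLin x = T.toLin x⁺ - T.toLin x⁻ := by rw [← map_sub, posPart_sub_negPart]
  rw [← posPart_add_negPart x, map_add, e]
  refine abs_le'.2 ⟨?_, ?_⟩
  swap
  · have a := h2 _ hp
    have b := h1 _ hn
    simp only [toLin_neg, LinearMap.neg_apply] at a
    rw [neg_sub, sub_eq_add_neg, add_comm]
    exact add_le_add a b
  · have a := h1 _ hp
    have b := h2 _ hn
    simp only [toLin_neg, LinearMap.neg_apply] at b
    rw [sub_eq_add_neg]
    exact add_le_add a b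

end RegOp

/-! ### Orthomorphisms and the diagonal -/

/-- A linear operator is band preserving if it leaves every band invariant. -/
def IsBandPreserving (T : E →ₗ[ℝ] E) : Prop := ∀ (B : Band E), ∀ x ∈ B, T x ∈ B

theorem isBandPreserving_of_isLUB {D : Set (RegOp E)} {T : RegOp E}
    (hD : ∀ S ∈ D, IsBandPreserving S.toLin) (h0 : D.Nonempty) (hT : IsLUB D T) :
    IsBandPreserving T.toLin := by
  have hpos : ∀ (B : Band E) (x : E), 0 ≤ x → x ∈ B → T.toLin x ∈ B := by
    intro B x hx hxB
    have key : ∀ p ∈ RegOp.sums D, p.1 ∈ B → p.2 ∈ B := by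
      intro p hp
      induction hp using AddSubmonoid.closure_induction with
      | mem p hp =>
        obtain ⟨S, hS, _, h⟩ := hp
        intro hpB
        rw [h]
        exact hD S hS B _ hpB
      | zero => exact fun h => h
      | add p q hp' hq' hp hq =>
        intro h
        have h1 := RegOp.sums_nonneg hp'
        have h2 := RegOp.sums_nonneg hq'
        refine B.add_mem (hp (B.solid ?_ h)) (hq (B.solid ?_ h))
        · rw [Prod.fst_add, abs_of_nonneg h1, abs_of_nonneg (add_nonneg h1 h2)]
          exact le_add_of_nonneg_right h2
        · rw [Prod.fst_add, abs_of_nonneg h2, abs_of_nonneg (add_nonneg h1 h2)]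
          exact le_add_of_nonneg_left h1
    obtain ⟨S, hS⟩ := h0
    exact B.sup_mem (fun y hy => key (x, y) hy hxB) ⟨_, RegOp.sums_basic hS hx⟩
      (RegOp.isLUB_apply ⟨S, hS⟩ hT hx)
  intro B x hx
  obtain ⟨_, h1, h2⟩ := abs_posPart_negPart_mem (s := (B : Set E))
    (fun _ _ h h' => B.solid h h') hx
  rw [← posPart_sub_negPart x, map_sub]
  exact B.sub_mem (hpos B _ (posPart_nonneg x) h1) (hpos B _ (negPart_nonneg x) h2)

variable (E) in
/-- The band `Orth(E)` in `L_r(E)` of all orthomorphisms, i.e. of all order bounded band preserving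
operators (regular operators are order bounded; on an order complete vector lattice, the order
bounded operators are exactly the regular ones). -/
def orth : Band (RegOp E) where
  carrier := {T | IsBandPreserving T.toLin}
  add_mem' hT hS B x hx := B.add_mem (hT B x hx) (hS B x hx)
  zero_mem' B _ _ := B.zero_mem
  smul_mem' c _ hT B x hx := B.smul_mem c (hT B x hx)
  solid' := by
    intro T S h hT B x hx
    have habs : IsBandPreserving (|T|).toLin := by
      refine isBandPreserving_of_isLUB (D := {T, -T}) ?_ ⟨T, by simp⟩ isLUB_pair
      rintro W (rfl | rfl)
      · exact hT
      · exact fun B x hx => B.neg_mem (hT B x hx)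
    have hxB : |x| ∈ B := B.solid (abs_abs x).le hx
    have h1 : |S.toLin x| ≤ (|T|).toLin |x| :=
      (RegOp.abs_apply_le S x).trans (h _ (abs_nonneg x))
    exact B.solid (h1.trans (le_abs_self _)) (habs B _ hxB)
  sup_mem' := fun _ _ hD h0 hT => isBandPreserving_of_isLUB hD h0 hT

/-- The diagonal `𝒫_E(T)` of a regular operator `T` on `E`: the image of `T` under the band
projection of `L_r(E)` onto `Orth(E)`. -/
noncomputable def diagonal : RegOp E →ₗ[ℝ] RegOp E := (orth E).proj

/-- The band projection as an operator `P_B : E → B`. -/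
noncomputable def Band.projOnto (B : Band E) : E →ₗ[ℝ] B.toSubmodule :=
  B.proj.codRestrict B.toSubmodule B.proj_mem

/-- The compression `P_B T P_B` of a regular operator on `E`, as a regular operator on `B`. -/
noncomputable def compress (B : Band E) (T : RegOp E) : RegOp B.toSubmodule :=
  ⟨B.projOnto ∘ₗ T.toLin ∘ₗ B.toSubmodule.subtype, by
    obtain ⟨P, Q, hP, hQ, h⟩ := T.2
    refine ⟨B.projOnto ∘ₗ P ∘ₗ B.toSubmodule.subtype, B.projOnto ∘ₗ Q ∘ₗ B.toSubmodule.subtype,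
      fun x hx => B.proj_nonneg (hP x hx), fun x hx => B.proj_nonneg (hQ x hx), ?_⟩
    rw [show T.toLin = P - Q from h, LinearMap.sub_comp, LinearMap.comp_sub]⟩

/-- A regular operator on a band `B`, regarded as an operator on `E = B ⊕ Bᵈ` that vanishes on
`Bᵈ`. -/
noncomputable def extendByZero (B : Band E) (S : RegOp B.toSubmodule) : RegOp E :=
  ⟨B.toSubmodule.subtype ∘ₗ S.toLin ∘ₗ B.projOnto, by
    obtain ⟨P, Q, hP, hQ, h⟩ := S.2
    refine ⟨B.toSubmodule.subtype ∘ₗ P ∘ₗ B.projOnto, B.toSubmodule.subtype ∘ₗ Q ∘ₗ B.projOnto,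
      fun x hx => hP _ (B.proj_nonneg hx), fun x hx => hQ _ (B.proj_nonneg hx), ?_⟩
    rw [show S.toLin = P - Q from h, LinearMap.sub_comp, LinearMap.comp_sub]⟩

/-- The diagonal `𝒫_B(T)` of `T` with respect to the band `B`: the diagonal, taken in the order
complete vector lattice `B`, of the compression `P_B T P_B`, regarded as an operator on `E` that
vanishes on `Bᵈ`. -/
noncomputable def diagonalWrt (B : Band E) (T : RegOp E) : RegOp E :=
  extendByZero B (diagonal (compress B T))

/-- The atomic diagonal: the diagonal with respect to the atomic part of `E`. -/
noncomputable def atomicDiagonal (T : RegOp E) : RegOp E := diagonalWrt (atomicPart E) T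

end Regular

end VecLat

namespace VecLat

set_option linter.unusedSectionVars false

/-! ### Disjoint complements are bands -/

section DisjointComplement

variable {V : Type*} [Lattice V] [AddCommGroup V] [IsOrderedAddMonoid V]

/-! Let `Z` be the set of orthomorphisms of `E` that vanish on `B`. An operator `T` satisfies
`𝒫_E(T) = 𝒫_B(T)` exactly when `T` is disjoint from `Z` (`diagonal_eq_diagonalWrt_iff`), and the
disjoint complement of any set is a band (`disjointComplBand`).

Write `D = 𝒫_E(T)`. The main point is `𝒫_B(T) = D P_B`, which follows once the diagonal commutes
with compression (`diagonal_compress`). By uniqueness of band decompositions, it suffices that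
compression sends `Orth(E)` into `Orth(B)` and the disjoint complement of `Orth(E)` into that of
`Orth(B)`. For the latter, an orthomorphism of `B` below the modulus of a compressed operator,
extended by zero, becomes an orthomorphism of `E` below the modulus of the original operator, so it
vanishes.

Now `T - D` is disjoint from `Orth(E)`, which contains `Z`, and `D P_B` is disjoint from `Z`
(`abs_inf_abs_eq_zero_of_proj`). Hence `T` is disjoint from `Z` iff `D - D P_B` is. But `D - D P_B`
itself lies in `Z`, so this means `D = D P_B`. -/

theorem mem_disjointCompl_of_le {S : Set V} {x y : V}
    (h : ∀ z ∈ S, |x| ⊓ |z| ≤ 0) (hyx : |y| ≤ |x|) : y ∈ disjointCompl S := fun z hz =>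
  le_antisymm ((inf_le_inf_right _ hyx).trans (h z hz)) (le_inf (abs_nonneg _) (abs_nonneg _))

/-- The parts `x⁺` and `x⁻` are treated separately. With `w = x⁺ ⊓ |y|`, each `d⁺` is disjoint from
`w` and both lie below `x⁺`, so `d⁺ + w = d⁺ ⊔ w ≤ x⁺`. Thus `x⁺ - w` bounds `D` from above, which
forces `w = 0`. The part `x⁻` lies below `d⁻` for any single `d ∈ D`. -/
theorem mem_disjointCompl_of_isLUB {S D : Set V} {x : V} (hD : D ⊆ disjointCompl S)
    (h0 : D.Nonempty) (hx : IsLUB D x) : x ∈ disjointCompl S := by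
  intro y hy
  refine le_antisymm ?_ (le_inf (abs_nonneg _) (abs_nonneg _))
  obtain ⟨d₀, hd₀⟩ := h0
  have hpos : x⁺ ⊓ |y| ≤ 0 := by
    have hw0 : 0 ≤ x⁺ ⊓ |y| := le_inf (posPart_nonneg x) (abs_nonneg y)
    have hle : x ≤ x⁺ - x⁺ ⊓ |y| := by
      refine hx.2 fun d hd => (le_posPart d).trans ?_
      have hdisj : d⁺ ⊓ (x⁺ ⊓ |y|) = 0 := by
        refine le_antisymm ?_ (le_inf (posPart_nonneg d) hw0)
        rw [← hD hd y hy]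
        refine inf_le_inf ?_ inf_le_right
        rw [← posPart_add_negPart d]
        exact le_add_of_nonneg_right (negPart_nonneg d)
      have hsum := inf_add_sup d⁺ (x⁺ ⊓ |y|)
      rw [hdisj, zero_add] at hsum
      rw [le_sub_iff_add_le, ← hsum]
      exact sup_le (posPart_mono (hx.1 hd)) inf_le_left
    have hle' : x⁺ ≤ x⁺ - x⁺ ⊓ |y| := sup_le hle (sub_nonneg.2 inf_le_left)
    simpa using hle'
  have hneg : x⁻ ⊓ |y| ≤ 0 := by
    rw [← hD hd₀ y hy]
    refine inf_le_inf_right _ ((negPart_anti (hx.1 hd₀)).trans ?_)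
    rw [← posPart_add_negPart d₀]
    exact le_add_of_nonneg_left (posPart_nonneg d₀)
  rw [← posPart_add_negPart x]
  exact (inf_add_le (posPart_nonneg x) (negPart_nonneg x) (abs_nonneg y)).trans
    (add_nonpos hpos hneg)

variable [Module ℝ V] [IsOrderedModule ℝ V]

theorem smul_mem_disjointCompl {S : Set V} (c : ℝ) {x : V} (hx : x ∈ disjointCompl S) :
    c • x ∈ disjointCompl S := by
  intro y hy
  refine le_antisymm ?_ (le_inf (abs_nonneg _) (abs_nonneg _))
  -- As `S` need not be closed under scalars, `c` cannot be moved onto `y`. A factor `k` dominating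
  -- both `|c|` and `1` gives `|c • x| ⊓ |y| ≤ k • (|x| ⊓ |y|)`.
  obtain ⟨k, hk1, hck⟩ : ∃ k : ℝ, 1 ≤ k ∧ |c| ≤ k := ⟨max 1 |c|, le_max_left _ _, le_max_right _ _⟩
  have hk : 0 < k := one_pos.trans_le hk1
  have key : k⁻¹ • (|c • x| ⊓ |y|) ≤ 0 := by
    rw [← hx y hy]
    have hscale : ∀ {u v : V}, u ≤ k • v → k⁻¹ • u ≤ v := fun {u v} h => by
      have := smul_le_smul_of_nonneg_left h (inv_nonneg.2 hk.le)
      rwa [smul_smul, inv_mul_cancel₀ hk.ne', one_smul] at this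
    refine le_inf (hscale (inf_le_left.trans ?_)) (hscale (inf_le_right.trans ?_))
    · exact (abs_smul_le c x).trans (smul_le_smul_of_nonneg_right hck (abs_nonneg x))
    · simpa using smul_le_smul_of_nonneg_right hk1 (abs_nonneg y)
  have := smul_le_smul_of_nonneg_left key hk.le
  rwa [smul_smul, mul_inv_cancel₀ hk.ne', one_smul, smul_zero] at this

/-- The disjoint complement of a set, as a band. -/
def disjointComplBand (S : Set V) : Band V where
  carrier := disjointCompl S
  add_mem' := disjointCompl_add
  zero_mem' y _ := by simp
  smul_mem' c _ := smul_mem_disjointCompl c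
  solid' _ _ h hx := mem_disjointCompl_of_le (fun z hz => (hx z hz).le) h
  sup_mem' _ _ := mem_disjointCompl_of_isLUB

end DisjointComplement

/-! ### Band projections and bands of a band -/

section BandFacts

variable {V : Type*} [ConditionallyCompleteLattice V] [AddCommGroup V] [IsOrderedAddMonoid V]
  [Module ℝ V]

namespace Band

/-- A supremum in `B` is a priori least only among upper bounds in `B`. The supremum in `V` exists
by order completeness and lies in `B` because `B` is a band, so the two agree. -/
theorem isLUB_coe (B : Band V) {D : Set B.toSubmodule} (h0 : D.Nonempty) {x : B.toSubmodule}
    (hx : IsLUB D x) : IsLUB ((↑) '' D : Set V) (x : V) := by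
  have hbdd : BddAbove ((↑) '' D : Set V) :=
    ⟨(x : V), by rintro _ ⟨y, hy, rfl⟩; exact hx.1 hy⟩
  have hlub := isLUB_csSup (h0.image ((↑) : B.toSubmodule → V)) hbdd
  have hmem : sSup ((↑) '' D : Set V) ∈ B :=
    B.sup_mem (by rintro _ ⟨y, _, rfl⟩; exact y.2) (h0.image _) hlub
  have hx' : IsLUB D (⟨_, hmem⟩ : B.toSubmodule) :=
    ⟨fun y hy => hlub.1 ⟨y, hy, rfl⟩, fun w hw => hlub.2 (by
      rintro _ ⟨y, hy, rfl⟩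
      exact hw hy)⟩
  rw [hx.unique hx']
  exact hlub

/-- The trace of a band `C` on a band `B`, as a band of `B`. -/
def restrict (B C : Band V) : Band B.toSubmodule where
  toSubmodule := C.toSubmodule.comap B.toSubmodule.subtype
  solid' _ _ h hx := C.solid (show |_| ≤ |_| from h) hx
  sup_mem' D x hD h0 hx := by
    refine C.sup_mem ?_ (h0.image _) (B.isLUB_coe h0 hx)
    rintro _ ⟨y, hy, rfl⟩
    exact hD hy

/-- A band of a band `B`, as a band of the whole space. -/
def ofBand (B : Band V) (C : Band B.toSubmodule) : Band V where
  toSubmodule := C.toSubmodule.map B.toSubmodule.subtype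
  solid' := by
    rintro _ y h ⟨x, hx, rfl⟩
    exact ⟨⟨y, B.solid h x.2⟩, C.solid h hx, rfl⟩
  sup_mem' D x hD h0 hx := by
    have hDB : ∀ y ∈ D, y ∈ B := fun y hy => by
      obtain ⟨z, _, rfl⟩ := hD hy
      exact z.2
    refine ⟨⟨x, B.sup_mem hDB h0 hx⟩, ?_, rfl⟩
    -- `D` is viewed inside `B`; its supremum in `V` lies in `B` and is therefore its supremum there
    -- too.
    refine C.sup_mem (D := {y | (y : V) ∈ D}) (fun y hy => ?_) ?_ ⟨fun y hy => hx.1 hy, fun w hw => ?_⟩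
    · obtain ⟨z, hz, hzy⟩ := hD hy
      obtain rfl : z = y := Subtype.ext hzy
      exact hz
    · obtain ⟨d, hd⟩ := h0
      exact ⟨⟨d, hDB d hd⟩, hd⟩
    · exact hx.2 fun d hd => hw (show (⟨d, hDB d hd⟩ : B.toSubmodule) ∈ {y : B.toSubmodule | (y : V) ∈ D} from hd)

theorem coe_mem_ofBand {B : Band V} {C : Band B.toSubmodule} {x : B.toSubmodule} :
    (x : V) ∈ B.ofBand C ↔ x ∈ C := by
  constructor
  · rintro ⟨y, hy, h⟩
    obtain rfl : y = x := Subtype.ext h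
    exact hy
  · exact fun hx => ⟨x, hx, rfl⟩

variable [IsOrderedModule ℝ V]

theorem proj_of_mem (B : Band V) {x : V} (hx : x ∈ B) : B.proj x = x :=
  B.proj_unique (B.proj_mem x) (B.sub_proj_mem x) hx (fun y _ => by simp)

theorem proj_proj (B : Band V) (x : V) : B.proj (B.proj x) = B.proj x :=
  B.proj_of_mem (B.proj_mem x)

/-- Since `x ≥ 0`, the negative part of `x - P x` is below `P x` as well as below `|x - P x|`. These
two are disjoint, so it vanishes. -/
theorem proj_le (B : Band V) {x : V} (hx : 0 ≤ x) : B.proj x ≤ x := by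
  have h0 := B.proj_nonneg hx
  have hdisj := B.sub_proj_mem x (B.proj x) (B.proj_mem x)
  rw [abs_of_nonneg h0] at hdisj
  have hneg : (x - B.proj x)⁻ ≤ 0 := by
    rw [← hdisj]
    refine le_inf ?_ ?_
    · rw [← posPart_add_negPart (x - B.proj x)]
      exact le_add_of_nonneg_left (posPart_nonneg _)
    · refine sup_le ?_ h0
      rw [neg_sub]
      exact sub_le_self _ hx
  rw [← sub_nonneg]
  exact negPart_eq_zero.1 (le_antisymm hneg (negPart_nonneg _))

/-- On positive vectors `0 ≤ P x ≤ x`, so solidity applies. This is why compressing or extending by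
zero preserves orthomorphisms. -/
theorem proj_mem_of_mem (B C : Band V) {x : V} (hx : x ∈ C) : B.proj x ∈ C := by
  have key : ∀ y, 0 ≤ y → y ∈ C → B.proj y ∈ C := fun y hy hyC => by
    refine C.solid ?_ hyC
    rw [abs_of_nonneg hy, abs_of_nonneg (B.proj_nonneg hy)]
    exact B.proj_le hy
  obtain ⟨_, hp, hn⟩ := abs_posPart_negPart_mem (s := (C : Set V))
    (fun _ _ h h' => C.solid h h') hx
  rw [← posPart_sub_negPart x, map_sub]
  exact C.sub_mem (key _ (posPart_nonneg x) hp) (key _ (negPart_nonneg x) hn)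

end Band

end BandFacts

/-! ### Compressions, extensions and the diagonal -/

section Diagonal

variable {E : Type*} [ConditionallyCompleteLattice E] [AddCommGroup E] [IsOrderedAddMonoid E]
  [Module ℝ E] [IsOrderedModule ℝ E]

namespace RegOp

theorem apply_nonneg {T : RegOp E} (hT : 0 ≤ T) {x : E} (hx : 0 ≤ x) : 0 ≤ T.toLin x := hT x hx

theorem apply_mono {T : RegOp E} (hT : 0 ≤ T) {x y : E} (h : x ≤ y) :
    T.toLin x ≤ T.toLin y := by
  rw [← sub_nonneg, ← map_sub]
  exact apply_nonneg hT (sub_nonneg.2 h)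

end RegOp

theorem compress_apply (B : Band E) (T : RegOp E) (x : B.toSubmodule) :
    ((compress B T).toLin x : E) = B.proj (T.toLin x) := rfl

theorem compress_sub (B : Band E) (T S : RegOp E) :
    compress B (T - S) = compress B T - compress B S := by
  refine RegOp.toLin_injective (LinearMap.ext fun x => Subtype.ext ?_)
  exact map_sub B.proj (T.toLin x) (S.toLin x)

/-- Compression is linear and monotone, so it carries `±T ≤ |T|` to the same bounds for the
compressed operators. -/
theorem abs_compress_le (B : Band E) (T : RegOp E) : |compress B T| ≤ compress B |T| := by
  have key : ∀ S : RegOp E, S ≤ |T| → compress B S ≤ compress B |T| := fun S hS x hx => by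
    change B.proj (S.toLin x) ≤ B.proj (|T|.toLin x)
    rw [← sub_nonneg, ← map_sub]
    exact B.proj_nonneg (sub_nonneg.2 (hS x hx))
  have hneg : compress B (-T) = -compress B T := by
    rw [← zero_sub T, compress_sub, show compress B (0 : RegOp E) = 0 from ?_, zero_sub]
    simpa using compress_sub B (0 : RegOp E) 0
  exact abs_le'.2 ⟨key T (le_abs_self T), hneg ▸ key (-T) (neg_le_abs T)⟩

theorem extendByZero_apply (B : Band E) (S : RegOp B.toSubmodule) (x : E) :
    (extendByZero B S).toLin x = (S.toLin ⟨B.proj x, B.proj_mem x⟩ : B.toSubmodule) := rfl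

theorem extendByZero_apply_coe (B : Band E) (S : RegOp B.toSubmodule) (x : B.toSubmodule) :
    (extendByZero B S).toLin x = S.toLin x := by
  rw [extendByZero_apply]
  congr 2
  exact Subtype.ext (B.proj_of_mem x.2)

/-- A band `C` of `E` is tested through its trace on `B`, which contains `P_B x` whenever `x ∈ C`.
-/
theorem extendByZero_mem_orth (B : Band E) {S : RegOp B.toSubmodule}
    (hS : S ∈ orth B.toSubmodule) : extendByZero B S ∈ orth E := by
  intro C x hx
  exact hS (B.restrict C) ⟨B.proj x, B.proj_mem x⟩ (B.proj_mem_of_mem C hx)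

/-- A band of `B` is also a band of `E`, hence invariant under both `T` and `P_B`. -/
theorem compress_mem_orth (B : Band E) {T : RegOp E} (hT : T ∈ orth E) :
    compress B T ∈ orth B.toSubmodule := by
  intro C x hx
  refine Band.coe_mem_ofBand.1 ?_
  rw [compress_apply]
  exact B.proj_mem_of_mem _ (hT (B.ofBand C) x (Band.coe_mem_ofBand.2 hx))

/-- Compressing an operator disjoint from the orthomorphisms of `E` gives an operator disjoint from
the orthomorphisms of `B`. -/
theorem compress_mem_disjointCompl_orth (B : Band E) {U : RegOp E}
    (hU : U ∈ disjointCompl (orth E : Set (RegOp E))) :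
    compress B U ∈ disjointCompl (orth B.toSubmodule : Set (RegOp B.toSubmodule)) := by
  intro S hS
  obtain ⟨R, hRdef⟩ : ∃ R, R = |compress B U| ⊓ |S| := ⟨_, rfl⟩
  rw [← hRdef]
  have hR0 : 0 ≤ R := hRdef ▸ le_inf (abs_nonneg _) (abs_nonneg _)
  have hRS : R ∈ orth B.toSubmodule := by
    refine (orth _).solid ?_ hS
    rw [abs_of_nonneg hR0, hRdef]
    exact inf_le_right
  have hRU : R ≤ compress B |U| := hRdef ▸ inf_le_left.trans (abs_compress_le B U)
  have hext0 : 0 ≤ extendByZero B R := fun x hx =>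
    RegOp.apply_nonneg hR0 (x := ⟨B.proj x, B.proj_mem x⟩) (B.proj_nonneg hx)
  -- On the positive cone, `R P_B ≤ P_B |U| P_B ≤ |U| P_B ≤ |U|`.
  have hextU : extendByZero B R ≤ |U| := fun x hx => by
    have h1 : (extendByZero B R).toLin x ≤ B.proj (|U|.toLin (B.proj x)) :=
      hRU ⟨B.proj x, B.proj_mem x⟩ (B.proj_nonneg hx)
    exact (h1.trans (B.proj_le (RegOp.apply_nonneg (abs_nonneg U) (B.proj_nonneg hx)))).trans
      (RegOp.apply_mono (abs_nonneg U) (B.proj_le hx))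
  -- The extension is an orthomorphism, so it is disjoint from `U`; lying between `0` and `|U|`, it
  -- equals its own infimum with `|U|`.
  have hzero : extendByZero B R = 0 := by
    have := hU _ (extendByZero_mem_orth B hRS)
    rwa [abs_of_nonneg hext0, inf_eq_right.2 hextU] at this
  refine RegOp.toLin_injective (LinearMap.ext fun x => Subtype.ext ?_)
  rw [← extendByZero_apply_coe, hzero]
  rfl

/-! ### Diagonals with respect to a band -/

theorem diagonal_mem_orth (T : RegOp E) : diagonal T ∈ orth E := (orth E).proj_mem T

theorem sub_diagonal_mem (T : RegOp E) :
    T - diagonal T ∈ disjointCompl (orth E : Set (RegOp E)) := (orth E).sub_proj_mem T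

/-- Taking the diagonal commutes with compression to a band. -/
theorem diagonal_compress (B : Band E) (T : RegOp E) :
    diagonal (compress B T) = compress B (diagonal T) := by
  refine (orth B.toSubmodule).proj_unique (diagonal_mem_orth _) (sub_diagonal_mem _)
    (compress_mem_orth B (diagonal_mem_orth T)) ?_
  rw [← compress_sub]
  exact compress_mem_disjointCompl_orth B (sub_diagonal_mem T)

/-- Here `𝒫_B(T) = P_B 𝒫_E(T) P_B`, and the outer projection is redundant because the orthomorphism
`𝒫_E(T)` leaves `B` invariant. -/
theorem diagonalWrt_apply (B : Band E) (T : RegOp E) (x : E) :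
    (diagonalWrt B T).toLin x = (diagonal T).toLin (B.proj x) := by
  rw [diagonalWrt, diagonal_compress]
  exact B.proj_of_mem (diagonal_mem_orth T B _ (B.proj_mem x))

theorem diagonalWrt_mem_orth (B : Band E) (T : RegOp E) : diagonalWrt B T ∈ orth E :=
  extendByZero_mem_orth B (diagonal_mem_orth _)

/-- Operators that vanish on `Bᵈ` are disjoint from operators that vanish on `B`. -/
theorem abs_inf_abs_eq_zero_of_proj (B : Band E) {T S : RegOp E}
    (hT : ∀ x, T.toLin (B.proj x) = T.toLin x) (hS : ∀ x, S.toLin (B.proj x) = 0) :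
    |T| ⊓ |S| = 0 := by
  obtain ⟨R, hRdef⟩ : ∃ R, R = |T| ⊓ |S| := ⟨_, rfl⟩
  have hR0 : 0 ≤ R := hRdef ▸ le_inf (abs_nonneg _) (abs_nonneg _)
  have hreg : ∀ W : RegOp E, W.toLin ∘ₗ B.proj ∈ regularSubmodule E := by
    intro W
    obtain ⟨P, Q, hP, hQ, h⟩ := W.2
    refine ⟨P ∘ₗ B.proj, Q ∘ₗ B.proj, fun x hx => hP _ (B.proj_nonneg hx),
      fun x hx => hQ _ (B.proj_nonneg hx), ?_⟩
    rw [show W.toLin = P - Q from h, LinearMap.sub_comp]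
  -- From `T = T P_B` both `T` and `-T` are below `|T| P_B`, hence so is `|T|`.
  have hTR : R ≤ ⟨|T|.toLin ∘ₗ B.proj, hreg _⟩ := by
    refine hRdef ▸ inf_le_left.trans (abs_le'.2 ⟨fun x hx => ?_, fun x hx => ?_⟩)
    · rw [← hT]
      exact le_abs_self T _ (B.proj_nonneg hx)
    · rw [RegOp.toLin_neg, LinearMap.neg_apply, ← hT]
      exact neg_le_abs T _ (B.proj_nonneg hx)
  -- Dually, `±S x = ±S (x - P_B x) ≤ |S| (x - P_B x)` for `x ≥ 0`.
  have hSR : R ≤ |S| - ⟨|S|.toLin ∘ₗ B.proj, hreg _⟩ := by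
    have key : ∀ W : RegOp E, W ≤ |S| → (∀ x, W.toLin (B.proj x) = 0) →
        W ≤ |S| - ⟨|S|.toLin ∘ₗ B.proj, hreg _⟩ := fun W hW hW0 x hx => by
      have h1 := hW _ (sub_nonneg.2 (B.proj_le hx))
      rw [map_sub, map_sub, hW0, sub_zero] at h1
      exact h1
    refine hRdef ▸ inf_le_right.trans (abs_le'.2 ⟨key S (le_abs_self S) hS,
      key (-S) (neg_le_abs S) fun x => ?_⟩)
    rw [RegOp.toLin_neg, LinearMap.neg_apply, hS, neg_zero]
  rw [← hRdef]
  refine le_antisymm (fun x hx => ?_) hR0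
  -- The bound by `S` kills `R` at `P_B x`, the bound by `T` kills it at `x - P_B x`; these vectors
  -- add up to `x`.
  have h1 : R.toLin (B.proj x) ≤ |S|.toLin (B.proj x) - |S|.toLin (B.proj (B.proj x)) :=
    hSR _ (B.proj_nonneg hx)
  have h2 : R.toLin (x - B.proj x) ≤ |T|.toLin (B.proj (x - B.proj x)) :=
    hTR _ (sub_nonneg.2 (B.proj_le hx))
  rw [B.proj_proj, sub_self] at h1
  rw [map_sub B.proj, B.proj_proj, sub_self, map_zero, map_sub, sub_nonpos] at h2
  exact h2.trans h1

/-- The diagonal of `T` equals the diagonal with respect to `B` iff `T` is disjoint from all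
orthomorphisms that vanish on `B`. -/
theorem diagonal_eq_diagonalWrt_iff (B : Band E) (T : RegOp E) :
    diagonal T = diagonalWrt B T ↔
      T ∈ disjointCompl {S : RegOp E | S ∈ orth E ∧ ∀ x, S.toLin (B.proj x) = 0} := by
  have hsum : T - diagonal T + diagonal T = T := sub_add_cancel _ _
  constructor
  · rintro h
    rw [← hsum]
    refine disjointCompl_add (fun S hS => sub_diagonal_mem T S hS.1) fun S hS => ?_
    refine abs_inf_abs_eq_zero_of_proj B (fun x => ?_) hS.2
    rw [← diagonalWrt_apply, ← h]
  · intro h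
    -- The difference `D - D P_B` belongs to the set and, by `h1`, to its disjoint complement; being
    -- disjoint from itself, it is zero.
    have hS : diagonal T - diagonalWrt B T ∈
        {S : RegOp E | S ∈ orth E ∧ ∀ x, S.toLin (B.proj x) = 0} := by
      refine ⟨(orth E).sub_mem (diagonal_mem_orth T) (diagonalWrt_mem_orth B T), fun x => ?_⟩
      rw [RegOp.toLin_sub, LinearMap.sub_apply, diagonalWrt_apply, B.proj_proj, sub_self]
    have h1 : diagonal T - diagonalWrt B T ∈
        disjointCompl {S : RegOp E | S ∈ orth E ∧ ∀ x, S.toLin (B.proj x) = 0} := by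
      have hdiag : diagonal T = T - (T - diagonal T) := (sub_sub_cancel _ _).symm
      refine disjointCompl_sub ?_ fun S hS => ?_
      · rw [hdiag]
        exact disjointCompl_sub h fun S hS => sub_diagonal_mem T S hS.1
      · refine abs_inf_abs_eq_zero_of_proj B (fun x => ?_) hS.2
        rw [diagonalWrt_apply, diagonalWrt_apply, B.proj_proj]
    have h2 := h1 _ hS
    rw [inf_idem] at h2
    exact sub_eq_zero.1 (le_antisymm (h2 ▸ le_abs_self _) (neg_nonpos.1 (h2 ▸ neg_le_abs _)))

theorem exists_band_diagonal_eq_diagonalWrt (B : Band E) :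
    ∃ M : Band (RegOp E), (M : Set (RegOp E)) = {T | diagonal T = diagonalWrt B T} :=
  ⟨disjointComplBand {S | S ∈ orth E ∧ ∀ x, S.toLin (B.proj x) = 0},
    Set.ext fun T => (diagonal_eq_diagonalWrt_iff B T).symm⟩

end Diagonal

end VecLat

theorem mainTheorem6 {E : Type*} [ConditionallyCompleteLattice E] [AddCommGroup E]
    [IsOrderedAddMonoid E] [Module ℝ E] [IsOrderedModule ℝ E] :
    (∀ B : VecLat.Band E, ∃ M : VecLat.Band (VecLat.RegOp E),
      (M : Set (VecLat.RegOp E)) =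
        {T | VecLat.diagonal T = VecLat.diagonalWrt B T}) ∧
    (∃ M : VecLat.Band (VecLat.RegOp E),
      (M : Set (VecLat.RegOp E)) =
        {T | VecLat.diagonal T = VecLat.atomicDiagonal T}) := by
  -- No property of atoms enters: the atomic diagonal is by definition the diagonal with respect to
  -- the band `atomicPart E`.
  exact ⟨VecLat.exists_band_diagonal_eq_diagonalWrt,
    VecLat.exists_band_diagonal_eq_diagonalWrt (VecLat.atomicPart E)⟩
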